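/- Let $\mathcal{E} \subset \mathbb{R}^2$ be a (solid, non-degenerate) ellipse centred at the origin, let $N \ge 2$ be an integer, and let $x_1, \dots, x_N$ be independent random points distributed uniformly in $\mathcal{E}$. Define the random variable $$V_{\mathcal{E},N} = \frac{\operatorname{vol}_2\bigl(\operatorname{conv}\{\pm x_1, \pm x_2, \dots, \pm x_N\}\bigr)}{\operatorname{vol}_2(\mathcal{E})}.$$ Then $$\mathbb{E}\, V_{\mathcal{E},N} = 1 - \frac{2N}{3\pi^N} \int_0^\pi (t + \sin t)^{N-1} (1 + \cos t)^2 \, dt.$$ -/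

import Mathlib

/-- A (solid) ellipse in the plane centred at the origin: with respect to some orthonormal basis
`b` and some semi-axes `a 0, a 1 > 0`, the set of points `x` with
`(⟪b 0, x⟫ / a 0) ^ 2 + (⟪b 1, x⟫ / a 1) ^ 2 ≤ 1`. -/
def IsCenteredEllipse (E : Set (EuclideanSpace ℝ (Fin 2))) : Prop :=
  ∃ (b : OrthonormalBasis (Fin 2) ℝ (EuclideanSpace ℝ (Fin 2))) (a : Fin 2 → ℝ),
    (∀ i, 0 < a i) ∧ E = {x | ∑ i, (inner ℝ (b i) x / a i) ^ 2 ≤ 1}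

/-- The symmetric convex hull `conv {± x₁, …, ± x_N}` of finitely many points. -/
def symmetricHull {n N : ℕ} (x : Fin N → EuclideanSpace ℝ (Fin n)) :
    Set (EuclideanSpace ℝ (Fin n)) :=
  convexHull ℝ (Set.range x ∪ Set.range (fun i => -x i))

/-- The normalized volume `vol (conv {± x₁, …, ± x_N}) / vol K`. -/
noncomputable def normalizedSymVolume {n N : ℕ} (K : Set (EuclideanSpace ℝ (Fin n)))
    (x : Fin N → EuclideanSpace ℝ (Fin n)) : ℝ :=
  MeasureTheory.volume.real (symmetricHull x) / MeasureTheory.volume.real K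

/-!
By linear invariance the ellipse may be replaced by the unit disc with its uniform distribution
`ρ`. By Efron's identity, the mean mass of the symmetric hull of `N` points is one minus the
probability that a further point `p` is outside it. In that case, almost surely exactly one `i` is
such that the segment from `p` to the counterclockwise one of `± xᵢ` is an edge of the symmetric
hull of all the points, which says that the other `xⱼ` lie in the strip between the line carrying
this edge and its reflection in the origin. So the probability is `N` times the mean of the
`(N - 1)`-st power of the mass of that strip. By symmetry of `ρ`, the counterclockwise one of `± q`
may be replaced by `q`.

The mass of the strip depends only on the distance `y` from the origin to the line through `p` and
`q`, and integrating over `p` and `q` on a fixed chord produces the weight `ℓ ^ 3 / 6`, where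
`ℓ = 2 √(1 - y ^ 2)` is its length. For `y = sin (t / 2)` the strip has area `t + sin t`, and
`ℓ ^ 3 dy` is a multiple of `cos (t / 2) ^ 4 dt`, that is, of `(1 + cos t) ^ 2 dt`.
-/

open MeasureTheory Set Metric
open scoped ENNReal Pointwise ProbabilityTheory ComplexConjugate

section AbsConvexHull

variable {ι V W : Type*} [AddCommGroup V] [Module ℝ V] [AddCommGroup W] [Module ℝ W]

lemma convexHull_range_union_range_neg (x : ι → V) :
    convexHull ℝ (range x ∪ range fun i => -x i) = absConvexHull ℝ (range x) := by
  rw [← convexHull_union_neg_eq_absConvexHull, ← image_neg_eq_neg, ← range_comp]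
  rfl

lemma image_absConvexHull (f : V →ₗ[ℝ] W) (s : Set V) :
    f '' absConvexHull ℝ s = absConvexHull ℝ (f '' s) := by
  rw [← convexHull_union_neg_eq_absConvexHull, ← convexHull_union_neg_eq_absConvexHull,
    f.image_convexHull, image_union, image_neg]

lemma image_absConvexHull_range (f : V →ₗ[ℝ] W) (x : ι → V) :
    f '' absConvexHull ℝ (range x) = absConvexHull ℝ (range fun i => f (x i)) := by
  rw [image_absConvexHull, ← range_comp]
  rfl

lemma absConvex_image (f : V →ₗ[ℝ] W) {s : Set V} (hs : AbsConvex ℝ s) :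
    AbsConvex ℝ (f '' s) := by
  rw [← absConvexHull_eq_self, ← image_absConvexHull, absConvexHull_eq_self.2 hs]

lemma mem_absConvexHull_range_iff [Fintype ι] {x : ι → V} {p : V} :
    p ∈ absConvexHull ℝ (range x) ↔ ∃ w ∈ stdSimplex ℝ (ι ⊕ ι),
      ∑ i, w (Sum.inl i) • x i - ∑ i, w (Sum.inr i) • x i = p := by
  classical
  have hrange : range x ∪ range (fun i => -x i) =
      Fintype.linearCombination ℝ (Sum.elim x fun i => -x i) ''
        range fun i : ι ⊕ ι => (Pi.single i 1 : ι ⊕ ι → ℝ) := by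
    rw [← Sum.elim_range, ← range_comp]
    congr 1
    ext i
    simp [Fintype.linearCombination_apply_single]
  rw [← convexHull_range_union_range_neg, hrange, ← LinearMap.image_convexHull,
    convexHull_rangle_single_eq_stdSimplex]
  simp [Fintype.linearCombination_apply, sub_eq_add_neg]

lemma isClosed_setOf_mem_absConvexHull_range [Finite ι] [TopologicalSpace V] [T2Space V]
    [IsTopologicalAddGroup V] [ContinuousSMul ℝ V] :
    IsClosed {y : V × (ι → V) | y.1 ∈ absConvexHull ℝ (range y.2)} := by
  have := Fintype.ofFinite ι
  have : CompactSpace (stdSimplex ℝ (ι ⊕ ι)) :=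
    isCompact_iff_compactSpace.1 (isCompact_stdSimplex ℝ (ι ⊕ ι))
  have himage : {y : V × (ι → V) | y.1 ∈ absConvexHull ℝ (range y.2)} =
      Prod.snd '' {z : stdSimplex ℝ (ι ⊕ ι) × (V × (ι → V)) |
        ∑ i, z.1.1 (Sum.inl i) • z.2.2 i - ∑ i, z.1.1 (Sum.inr i) • z.2.2 i = z.2.1} := by
    ext y
    simp [mem_absConvexHull_range_iff]
  rw [himage]
  refine isClosedMap_snd_of_compactSpace _ (isClosed_eq ?_ (by fun_prop))
  have hweight : ∀ k, Continuous fun z : stdSimplex ℝ (ι ⊕ ι) × (V × (ι → V)) => z.1.1 k :=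
    fun k => (continuous_apply k).comp (continuous_subtype_val.comp continuous_fst)
  exact .sub (continuous_finsetSum _ fun i _ => (hweight _).smul (by fun_prop))
    (continuous_finsetSum _ fun i _ => (hweight _).smul (by fun_prop))

lemma convex_halfSpace_lt_union_singleton (f : V →ₗ[ℝ] ℝ) (q : V) :
    Convex ℝ ({z | f z < f q} ∪ {q}) := by
  refine convex_iff_pairwise_pos.2 fun u hu v hv huv a b ha hb hab => Or.inl ?_
  have hq : f q = a * f q + b * f q := by rw [← add_mul, hab, one_mul]
  have hcomb : f (a • u + b • v) = a * f u + b * f v := by simp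
  simp only [mem_union, mem_ofPred_eq, mem_singleton_iff] at hu hv
  rw [mem_ofPred_eq, hcomb, hq]
  rcases hu with hu | rfl <;> rcases hv with hv | rfl
  · gcongr
  · gcongr
  · gcongr
  · exact absurd rfl huv

end AbsConvexHull

section PlaneGeometry

variable {V : Type*} [NormedAddCommGroup V] [InnerProductSpace ℝ V]
  [Fact (Module.finrank ℝ V = 2)] (o : Orientation ℝ V (Fin 2))

local notation "ω" => o.areaForm

lemma areaForm_smul_add_cyclic (a b c : V) : ω a b • c + ω b c • a + ω c a • b = 0 := by
  rcases eq_or_ne a 0 with rfl | ha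
  · simp
  set v := ω a b • c + ω b c • a + ω c a • b with hv
  have harea : ω a v = 0 := by
    simp only [hv, map_add, map_smul, smul_eq_mul, o.areaForm_apply_self, o.areaForm_swap c a]
    ring
  have hinner : inner ℝ a v = 0 := by
    simp only [hv, inner_add_right, real_inner_smul_right, real_inner_self_eq_norm_sq,
      o.areaForm_swap c a]
    linarith [o.inner_mul_areaForm_sub a b c]
  have hnorm := o.inner_sq_add_areaForm_sq a v
  rw [hinner, harea] at hnorm
  simpa [ha] using hnorm.symm

/-- Whichever of `z` and `-z` lies counterclockwise from `p`, and `-z` if both are parallel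
to `p`. -/
noncomputable def ccw (p z : V) : V := if 0 < ω p z then z else -z

/-- The open strip between the line through `p` and `q` and its reflection in the origin. -/
def strip (p q : V) : Set V := {z | |ω (p - q) z| < |ω p q|}

/-- The segment from `p` to the counterclockwise one of `± x i` is an edge of the symmetric hull
of `p` and `x`, all the other points being inside the strip between its line and the opposite
one. -/
def IsEdgeFrom {ι : Type*} (p : V) (x : ι → V) (i : ι) : Prop :=
  ∀ j ≠ i, x j ∈ strip o p (ccw o p (x i))

variable {o} {ι : Type*} {p q : V} {x : ι → V} {i j : ι}

lemma ccw_eq_or_eq_neg (p z : V) : ccw o p z = z ∨ ccw o p z = -z := by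
  unfold ccw
  split_ifs <;> simp

lemma areaForm_ccw (p z : V) : ω p (ccw o p z) = |ω p z| := by
  unfold ccw
  split_ifs with h
  · rw [abs_of_pos h]
  · rw [map_neg, abs_of_nonpos (not_lt.1 h)]

lemma ccw_mem_absConvexHull (p : V) (x : ι → V) (i : ι) :
    ccw o p (x i) ∈ absConvexHull ℝ (range x) := by
  have hmem : x i ∈ absConvexHull ℝ (range x) := subset_absConvexHull (mem_range_self i)
  rcases ccw_eq_or_eq_neg (o := o) p (x i) with h | h <;> rw [h]
  exacts [hmem, balanced_absConvexHull.neg_mem_iff.2 hmem]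

lemma strip_comm (p q : V) : strip o p q = strip o q p := by
  ext z
  rw [strip, strip, mem_ofPred_eq, mem_ofPred_eq, ← neg_sub q p, map_neg, LinearMap.neg_apply,
    abs_neg, o.areaForm_swap p q, abs_neg]

lemma neg_mem_strip {z : V} : -z ∈ strip o p q ↔ z ∈ strip o p q := by
  rw [strip, mem_ofPred_eq, mem_ofPred_eq, map_neg, abs_neg]

lemma ccw_mem_strip {r z : V} : ccw o r z ∈ strip o p q ↔ z ∈ strip o p q := by
  rcases ccw_eq_or_eq_neg (o := o) r z with h | h <;> simp [h, neg_mem_strip]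

lemma mem_strip_ccw {z : V} :
    z ∈ strip o p (ccw o p q) ↔
      |ω p (ccw o p z) - ω (ccw o p q) (ccw o p z)| < ω p (ccw o p q) := by
  rw [← ccw_mem_strip (r := p), strip, mem_ofPred_eq, map_sub, LinearMap.sub_apply,
    areaForm_ccw p q, abs_abs]

lemma isEdgeFrom_unique (hi : IsEdgeFrom o p x i) (hj : IsEdgeFrom o p x j) : i = j := by
  by_contra hij
  have hlti := (abs_lt.1 (mem_strip_ccw.1 (hi j (Ne.symm hij)))).2
  have hltj := (abs_lt.1 (mem_strip_ccw.1 (hj i hij))).2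
  linarith [o.areaForm_swap (ccw o p (x i)) (ccw o p (x j))]

lemma notMem_absConvexHull_of_isEdgeFrom (hne : ω p (x i) ≠ 0) (hi : IsEdgeFrom o p x i) :
    p ∉ absConvexHull ℝ (range x) := by
  set q := ccw o p (x i) with hq
  have hpos : 0 < ω p q := by rw [hq, areaForm_ccw]; exact abs_pos.2 hne
  have hfp : ω (p - q) p = ω p q := by simp [o.areaForm_swap p q]
  have hfq : ω (p - q) q = ω p q := by simp
  have hneg : -q ∈ {z | ω (p - q) z < ω (p - q) q} := by simpa using hpos
  have hmem : ∀ j, x j ∈ {z | ω (p - q) z < ω (p - q) q} ∪ {q} ∧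
      -x j ∈ {z | ω (p - q) z < ω (p - q) q} ∪ {q} := by
    intro j
    rcases eq_or_ne j i with rfl | hj
    · rcases ccw_eq_or_eq_neg (o := o) p (x j) with h | h <;> rw [← hq] at h
      · exact h ▸ ⟨Or.inr rfl, Or.inl hneg⟩
      · rw [← h, ← neg_neg (x j), ← h]
        exact ⟨Or.inl hneg, Or.inr rfl⟩
    · have hlt : |ω (p - q) (x j)| < |ω p q| := hi j hj
      rw [abs_of_pos hpos, ← hfq] at hlt
      have hlt' := abs_lt.1 hlt
      refine ⟨Or.inl hlt'.2, Or.inl ?_⟩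
      rw [mem_ofPred_eq, map_neg]
      linarith
  have hsubset : range x ∪ range (fun j => -x j) ⊆ {z | ω (p - q) z < ω (p - q) q} ∪ {q} :=
    union_subset (range_subset_iff.2 fun j => (hmem j).1) (range_subset_iff.2 fun j => (hmem j).2)
  rw [← convexHull_range_union_range_neg]
  intro hp
  rcases convexHull_min hsubset (convex_halfSpace_lt_union_singleton _ _) hp with h | h
  · exact h.ne (hfp.trans hfq.symm)
  · rw [← mem_singleton_iff.1 h, o.areaForm_apply_self] at hpos
    exact hpos.false

lemma exists_forall_areaForm_sub_nonneg [Finite ι] [Nonempty ι] {z : ι → V}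
    (hz : ∀ i, 0 < ω p (z i)) : ∃ i, ∀ j, 0 ≤ ω (p - z i) (p - z j) := by
  -- Minimize the cotangent of the angle at `p` between `-p` and `z i - p`.
  obtain ⟨i, hi⟩ := Finite.exists_min fun i => inner ℝ p (p - z i) / ω p (z i)
  refine ⟨i, fun j => ?_⟩
  have hp : 0 < ‖p‖ ^ 2 := by
    have : p ≠ 0 := by
      rintro rfl
      simpa using hz i
    positivity
  have hcot := (div_le_div_iff₀ (hz i) (hz j)).1 (hi j)
  have harea : ∀ k, ω p (p - z k) = -ω p (z k) := fun k => by simp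
  refine nonneg_of_mul_nonneg_right (a := ‖p‖ ^ 2) ?_ hp
  rw [← o.inner_mul_areaForm_sub, harea, harea]
  linarith

lemma mem_of_areaForm_add_le {s : Set V} (hs : AbsConvex ℝ s) {a b : V} (ha : a ∈ s) (hb : b ∈ s)
    (hpa : 0 < ω p a) (hpb : 0 < ω p b) (h : ω p a + ω p b ≤ ω a b) : p ∈ s := by
  have hab : 0 < ω a b := by linarith
  have hcramer : ω a b • p = ω p b • a + ω p a • -b := by
    have := areaForm_smul_add_cyclic (o := o) a b p
    rw [o.areaForm_swap b p] at this
    linear_combination (norm := module) this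
  have hmem : ω a b • p ∈ (ω p b + ω p a) • s := by
    rw [hcramer, hs.2.add_smul hpb.le hpa.le]
    exact add_mem_add (smul_mem_smul_set ha) (smul_mem_smul_set (hs.1.neg_mem_iff.2 hb))
  refine (smul_mem_smul_set_iff₀ hab.ne' _ _).1 (hs.1.smul_mono ?_ hmem)
  rw [Real.norm_of_nonneg (by positivity), Real.norm_of_nonneg hab.le]
  linarith

lemma exists_isEdgeFrom [Finite ι] [Nonempty ι] (hne : ∀ i, ω p (x i) ≠ 0)
    (hstrip : ∀ i j, j ≠ i → |ω (p - ccw o p (x i)) (x j)| ≠ |ω p (ccw o p (x i))|)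
    (hp : p ∉ absConvexHull ℝ (range x)) : ∃ i, IsEdgeFrom o p x i := by
  have hpos : ∀ i, 0 < ω p (ccw o p (x i)) := fun i => by
    rw [areaForm_ccw]
    exact abs_pos.2 (hne i)
  obtain ⟨i, hi⟩ := exists_forall_areaForm_sub_nonneg hpos
  refine ⟨i, fun j hj => lt_of_le_of_ne ?_ (hstrip i j hj)⟩
  set a := ccw o p (x i)
  set b := ccw o p (x j)
  have hupper : ω (p - a) b ≤ ω p a := by
    have := hi j
    simp only [map_sub, LinearMap.sub_apply, o.areaForm_apply_self, o.areaForm_swap a p] at this ⊢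
    linarith
  have hlower : -ω p a ≤ ω (p - a) b := by
    by_contra! hlt
    rw [map_sub, LinearMap.sub_apply] at hlt
    exact hp (mem_of_areaForm_add_le absConvex_absConvexHull (ccw_mem_absConvexHull p x i)
      (ccw_mem_absConvexHull p x j) (hpos i) (hpos j) (by linarith))
  have habs : |ω (p - a) (x j)| = |ω (p - a) b| := by
    rcases ccw_eq_or_eq_neg (o := o) p (x j) with h | h
    · rw [← h]
    · rw [← abs_neg, ← map_neg, ← h]
  rw [habs, abs_of_pos (hpos i)]
  exact abs_le.2 ⟨hlower, hupper⟩

end PlaneGeometry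

section ProductMeasure

variable {α : Type*} [MeasurableSpace α]

lemma ae_pi_of_ae_prod {ι : Type*} [Fintype ι] {μ : ι → Measure α}
    [∀ i, IsProbabilityMeasure (μ i)] {i j : ι} (hij : i ≠ j) {P : α × α → Prop}
    (h : ∀ᵐ y ∂(μ i).prod (μ j), P y) : ∀ᵐ x ∂Measure.pi μ, P (x i, x j) := by
  have hindep : ProbabilityTheory.iIndepFun (fun k (x : ι → α) => x k) (Measure.pi μ) :=
    ProbabilityTheory.iIndepFun_pi (X := fun _ => id) fun _ => aemeasurable_id
  have hlaw := (ProbabilityTheory.indepFun_iff_map_prod_eq_prod_map_map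
    (measurable_pi_apply i).aemeasurable (measurable_pi_apply j).aemeasurable).1
    (hindep.indepFun hij)
  rw [(measurePreserving_eval μ i).map_eq, (measurePreserving_eval μ j).map_eq] at hlaw
  rw [← hlaw] at h
  exact ae_of_ae_map (by fun_prop) h

lemma measure_pi_forall_mem {n : ℕ} (μ : Measure α) [IsProbabilityMeasure μ] (i : Fin (n + 1))
    {S : Set (α × α)} (hS : MeasurableSet S) :
    Measure.pi (fun _ => μ) {x | ∀ j ≠ i, (x i, x j) ∈ S} = ∫⁻ a, μ (Prod.mk a ⁻¹' S) ^ n ∂μ := by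
  let T : Set (α × (Fin n → α)) := {y | ∀ k, (y.1, y.2 k) ∈ S}
  have hT : MeasurableSet T := by
    rw [show T = ⋂ k, {y | (y.1, y.2 k) ∈ S} from ofPred_forall _]
    exact .iInter fun k =>
      hS.preimage (measurable_fst.prodMk ((measurable_pi_apply k).comp measurable_snd))
  have hpre : {x : Fin (n + 1) → α | ∀ j ≠ i, (x i, x j) ∈ S} =
      MeasurableEquiv.piFinSuccAbove (fun _ => α) i ⁻¹' T := by
    ext x
    refine ⟨fun h k => h _ (Fin.succAbove_ne i k), fun h j hj => ?_⟩
    obtain ⟨k, rfl⟩ := Fin.exists_succAbove_eq hj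
    exact h k
  rw [hpre, (measurePreserving_piFinSuccAbove (fun _ : Fin (n + 1) => μ) i).measure_preimage
    hT.nullMeasurableSet, Measure.prod_apply hT]
  refine lintegral_congr fun a => ?_
  have hpi : Prod.mk a ⁻¹' T = Set.pi univ fun _ : Fin n => Prod.mk a ⁻¹' S := by
    ext z
    simp [T]
  rw [hpi, Measure.pi_pi, Finset.prod_const, Finset.card_univ, Fintype.card_fin]

end ProductMeasure

/-- The measure `μ` vanishes on all affine hyperplanes. -/
def ChargesNoHyperplane {V : Type*} [AddCommGroup V] [Module ℝ V] [MeasurableSpace V]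
    (μ : Measure V) : Prop :=
  ∀ f : V →ₗ[ℝ] ℝ, f ≠ 0 → ∀ c, ∀ᵐ z ∂μ, f z ≠ c

lemma ae_ne_zero_of_chargesNoHyperplane {V : Type*} [AddCommGroup V] [Module ℝ V] [Nontrivial V]
    [MeasurableSpace V] {μ : Measure V} (hμ : ChargesNoHyperplane μ) : ∀ᵐ z ∂μ, z ≠ 0 := by
  obtain ⟨f, hf⟩ := exists_ne (0 : V →ₗ[ℝ] ℝ)
  filter_upwards [hμ f hf 0] with z hz
  rintro rfl
  exact hz (map_zero f)

lemma chargesNoHyperplane_of_absolutelyContinuous {V : Type*} [NormedAddCommGroup V]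
    [NormedSpace ℝ V] [FiniteDimensional ℝ V] [MeasurableSpace V] [BorelSpace V] {μ ν : Measure V}
    [ν.IsAddHaarMeasure] (h : μ ≪ ν) : ChargesNoHyperplane μ := fun f hf c =>
  h.ae_le ((ae_comp_linearMap_mem_iff f ν volume (LinearMap.surjective hf)
    (measurableSet_singleton c).compl).2 (Measure.ae_ne volume c))

/-- The mean `ρ`-mass of the symmetric hull of `N` independent points with law `ρ`. -/
noncomputable def meanHullMass {V : Type*} [AddCommGroup V] [Module ℝ V] [MeasurableSpace V]
    (ρ : Measure V) (N : ℕ) : ℝ :=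
  ∫ x, ρ.real (absConvexHull ℝ (range x)) ∂Measure.pi fun _ : Fin N => ρ

section Measurability

variable {ι V : Type*} [Finite ι] [NormedAddCommGroup V] [NormedSpace ℝ V]
  [SecondCountableTopology V] [MeasurableSpace V] [BorelSpace V]

lemma measurableSet_mem_absConvexHull_range :
    MeasurableSet {y : V × (ι → V) | y.1 ∈ absConvexHull ℝ (range y.2)} :=
  isClosed_setOf_mem_absConvexHull_range.measurableSet

lemma measurable_measure_absConvexHull_range (ρ : Measure V) [SFinite ρ] :
    Measurable fun x : ι → V => ρ (absConvexHull ℝ (range x)) :=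
  measurable_measure_prodMk_right measurableSet_mem_absConvexHull_range

lemma meanHullMass_eq_one_sub (ρ : Measure V) [IsProbabilityMeasure ρ] (N : ℕ) :
    meanHullMass ρ N = 1 - (ρ.prod (Measure.pi fun _ : Fin N => ρ)).real
      {y | y.1 ∉ absConvexHull ℝ (range y.2)} := by
  have hmeas := measurableSet_mem_absConvexHull_range (ι := Fin N) (V := V)
  have hmass : meanHullMass ρ N = (ρ.prod (Measure.pi fun _ : Fin N => ρ)).real
      {y | y.1 ∈ absConvexHull ℝ (range y.2)} := by
    rw [Measure.real, Measure.prod_apply_symm hmeas]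
    exact integral_toReal (measurable_measure_absConvexHull_range ρ).aemeasurable
      (.of_forall fun _ => measure_lt_top _ _)
  have hcompl := probReal_compl_eq_one_sub (μ := ρ.prod (Measure.pi fun _ : Fin N => ρ)) hmeas
  rw [compl_ofPred] at hcompl
  rw [hcompl, hmass, sub_sub_cancel]

end Measurability

section PlaneMeasure

variable {V : Type*} [NormedAddCommGroup V] [InnerProductSpace ℝ V]
  [Fact (Module.finrank ℝ V = 2)] {o : Orientation ℝ V (Fin 2)}

local notation "ω" => o.areaForm

attribute [local instance] FiniteDimensional.of_fact_finrank_eq_two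

lemma areaForm_ne_zero {v : V} (hv : v ≠ 0) : ω v ≠ 0 := by
  intro h
  have := o.areaForm_rightAngleRotation_right v v
  rw [h, LinearMap.zero_apply, real_inner_self_eq_norm_sq] at this
  exact hv (by simpa using this.symm)

variable [MeasurableSpace V] [BorelSpace V]

lemma measurable_areaForm {α : Type*} [MeasurableSpace α] {f g : α → V} (hf : Measurable f)
    (hg : Measurable g) : Measurable fun a => ω (f a) (g a) :=
  o.areaForm'.continuous₂.measurable.comp (hf.prodMk hg)

lemma measurable_ccw {α : Type*} [MeasurableSpace α] {f g : α → V} (hf : Measurable f)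
    (hg : Measurable g) : Measurable fun a => ccw o (f a) (g a) :=
  .ite (measurableSet_lt measurable_const (measurable_areaForm hf hg)) hg hg.neg

lemma measurableSet_mem_strip {α : Type*} [MeasurableSpace α] {f g h : α → V} (hf : Measurable f)
    (hg : Measurable g) (hh : Measurable h) : MeasurableSet {a | h a ∈ strip o (f a) (g a)} :=
  measurableSet_lt (measurable_areaForm (hf.sub hg) hh).norm (measurable_areaForm hf hg).norm

variable {μ : Measure V}

lemma measurable_measure_strip [SFinite μ] : Measurable fun y : V × V => μ (strip o y.1 y.2) :=
  measurable_measure_prodMk_left (measurableSet_mem_strip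
    (measurable_fst.comp measurable_fst) (measurable_snd.comp measurable_fst) measurable_snd)

lemma measurableSet_isEdgeFrom {ι : Type*} [Countable ι] (p : V) (i : ι) :
    MeasurableSet {x : ι → V | IsEdgeFrom o p x i} := by
  simp only [IsEdgeFrom, ofPred_forall]
  exact .iInter fun j => .iInter fun _ => measurableSet_mem_strip measurable_const
    (measurable_ccw measurable_const (measurable_pi_apply i)) (measurable_pi_apply j)

lemma ae_abs_areaForm_sub_ccw_ne [SFinite μ] (hμ : ChargesNoHyperplane μ) {p : V} (hp : p ≠ 0) :
    ∀ᵐ y ∂μ.prod μ, |ω (p - ccw o p y.1) y.2| ≠ |ω p (ccw o p y.1)| := by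
  have hccw : Measurable fun y : V × V => ccw o p y.1 :=
    measurable_ccw measurable_const measurable_fst
  refine (Measure.ae_prod_iff_ae_ae (measurableSet_eq_fun
    (measurable_areaForm (hccw.const_sub p) measurable_snd).norm
    (measurable_areaForm measurable_const hccw).norm).compl).2 ?_
  filter_upwards [hμ _ (areaForm_ne_zero (o := o) hp) 0] with z hz
  have hne : p - ccw o p z ≠ 0 := by
    intro h
    rw [← abs_pos, ← areaForm_ccw, ← sub_eq_zero.1 h, o.areaForm_apply_self] at hz
    exact hz.false
  filter_upwards [hμ _ (areaForm_ne_zero (o := o) hne) (ω p (ccw o p z)),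
    hμ _ (areaForm_ne_zero (o := o) hne) (-ω p (ccw o p z))] with w hpos hneg
  exact fun h => (abs_eq_abs.1 h).elim hpos hneg

lemma ae_notMem_absConvexHull_iff [IsProbabilityMeasure μ] (hμ : ChargesNoHyperplane μ) {p : V}
    (hp : p ≠ 0) {ι : Type*} [Fintype ι] [Nonempty ι] :
    ∀ᵐ x ∂Measure.pi fun _ : ι => μ,
      p ∉ absConvexHull ℝ (range x) ↔ ∃ i, IsEdgeFrom o p x i := by
  have hne : ∀ᵐ x ∂Measure.pi fun _ : ι => μ, ∀ i, ω p (x i) ≠ 0 := ae_all_iff.2 fun i =>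
    (measurePreserving_eval (fun _ => μ) i).quasiMeasurePreserving.ae
      (hμ _ (areaForm_ne_zero hp) 0)
  have hstrip : ∀ᵐ x ∂Measure.pi fun _ : ι => μ, ∀ i j, j ≠ i →
      |ω (p - ccw o p (x i)) (x j)| ≠ |ω p (ccw o p (x i))| := by
    simp only [ae_all_iff]
    exact fun i j hj => ae_pi_of_ae_prod (μ := fun _ => μ) hj.symm
      (P := fun y => |ω (p - ccw o p y.1) y.2| ≠ |ω p (ccw o p y.1)|)
      (ae_abs_areaForm_sub_ccw_ne hμ hp)
  filter_upwards [hne, hstrip] with x hne hstrip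
  exact ⟨exists_isEdgeFrom hne hstrip,
    fun ⟨i, hi⟩ => notMem_absConvexHull_of_isEdgeFrom (hne i) hi⟩

lemma measure_pi_notMem_absConvexHull [IsProbabilityMeasure μ] (hμ : ChargesNoHyperplane μ)
    (n : ℕ) {p : V} (hp : p ≠ 0) :
    Measure.pi (fun _ : Fin (n + 1) => μ) {x | p ∉ absConvexHull ℝ (range x)} =
      (n + 1) * ∫⁻ q, μ (strip o p (ccw o p q)) ^ n ∂μ := by
  have hedges : {x : Fin (n + 1) → V | p ∉ absConvexHull ℝ (range x)}
      =ᵐ[Measure.pi fun _ => μ] ⋃ i, {x | IsEdgeFrom o p x i} := by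
    rw [← ofPred_exists]
    exact (ae_notMem_absConvexHull_iff hμ hp).mono fun x hx => propext hx
  have hdisjoint : Pairwise (Function.onFun Disjoint
      fun i : Fin (n + 1) => {x | IsEdgeFrom o p x i}) := fun i j hij =>
    disjoint_left.2 fun x hi hj => hij (isEdgeFrom_unique hi hj)
  have hedge : ∀ i, Measure.pi (fun _ : Fin (n + 1) => μ) {x | IsEdgeFrom o p x i} =
      ∫⁻ q, μ (strip o p (ccw o p q)) ^ n ∂μ := fun i =>
    measure_pi_forall_mem μ i (S := {y | y.2 ∈ strip o p (ccw o p y.1)})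
      (measurableSet_mem_strip measurable_const (measurable_ccw measurable_const measurable_fst)
        measurable_snd)
  rw [measure_congr hedges, measure_iUnion hdisjoint (measurableSet_isEdgeFrom p), tsum_fintype]
  simp [hedge]

lemma lintegral_comp_ccw [SFinite μ] [μ.IsNegInvariant] {G : V × V → ℝ≥0∞}
    (hG : Measurable G) (hsymm : ∀ y, G y.swap = G y) :
    ∫⁻ y, G (y.1, ccw o y.1 y.2) ∂μ.prod μ = ∫⁻ y, G y ∂μ.prod μ := by
  let A : Set (V × V) := {y | 0 < ω y.1 y.2}
  have hA : MeasurableSet A :=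
    measurableSet_lt measurable_const (measurable_areaForm measurable_fst measurable_snd)
  have hturn : MeasurePreserving (fun y : V × V => (-y.2, y.1)) (μ.prod μ) (μ.prod μ) :=
    ((Measure.measurePreserving_neg μ).prod (.id μ)).comp Measure.measurePreserving_swap
  have hsplit : ∀ y : V × V, G (y.1, ccw o y.1 y.2) =
      A.indicator G y + Aᶜ.indicator G (-y.2, y.1) := by
    intro y
    have hmem : (-y.2, y.1) ∈ A ↔ y ∈ A := by simp [A, o.areaForm_swap y.2 y.1]
    by_cases hy : y ∈ A
    · have hccw : ccw o y.1 y.2 = y.2 := if_pos hy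
      simp [hy, hmem, hccw]
    · have hccw : ccw o y.1 y.2 = -y.2 := if_neg hy
      simpa [hy, hmem, hccw] using hsymm (-y.2, y.1)
  simp_rw [hsplit]
  rw [lintegral_add_left (hG.indicator hA), hturn.lintegral_comp (hG.indicator hA.compl),
    ← lintegral_add_left (hG.indicator hA)]
  exact lintegral_congr fun y => indicator_self_add_compl_apply A G y

lemma measure_prod_notMem_absConvexHull [IsProbabilityMeasure μ] [μ.IsNegInvariant]
    (hμ : ChargesNoHyperplane μ) (n : ℕ) :
    (μ.prod (Measure.pi fun _ : Fin (n + 1) => μ)) {y | y.1 ∉ absConvexHull ℝ (range y.2)} =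
      (n + 1) * ∫⁻ y, μ (strip o y.1 y.2) ^ n ∂μ.prod μ := by
  have hmeas : Measurable fun y : V × V => μ (strip o y.1 y.2) ^ n :=
    measurable_measure_strip.pow_const n
  have hmiss : MeasurableSet {y : V × (Fin (n + 1) → V) | y.1 ∉ absConvexHull ℝ (range y.2)} :=
    measurableSet_mem_absConvexHull_range.compl
  have : Nontrivial V := Module.nontrivial_of_finrank_eq_succ (Fact.out : Module.finrank ℝ V = 2)
  rw [Measure.prod_apply hmiss,
    ← lintegral_comp_ccw (o := o) hmeas fun y => by rw [Prod.fst_swap, Prod.snd_swap, strip_comm],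
    lintegral_prod (fun y : V × V => μ (strip o y.1 (ccw o y.1 y.2)) ^ n) (hmeas.comp
      (measurable_fst.prodMk (measurable_ccw measurable_fst measurable_snd))).aemeasurable,
    ← lintegral_const_mul' _ _ (by finiteness)]
  refine lintegral_congr_ae ?_
  filter_upwards [ae_ne_zero_of_chargesNoHyperplane hμ] with p hp
  exact measure_pi_notMem_absConvexHull hμ n hp

end PlaneMeasure

section ChordIntegrals

lemma volume_chord_inter_translate {r : ℝ} (hr : 0 ≤ r) (y : ℝ) :
    volume {x : ℝ | x ^ 2 + y ^ 2 ≤ 1 ∧ (x + r) ^ 2 + y ^ 2 ≤ 1} =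
      ENNReal.ofReal (2 * √(1 - y ^ 2) - r) := by
  rcases le_or_gt (y ^ 2) 1 with hy | hy
  · have hchord : ∀ x : ℝ, x ^ 2 + y ^ 2 ≤ 1 ↔ |x| ≤ √(1 - y ^ 2) := fun x => by
      rw [Real.le_sqrt (abs_nonneg x) (by linarith), sq_abs, le_sub_iff_add_le]
    have hset : {x : ℝ | x ^ 2 + y ^ 2 ≤ 1 ∧ (x + r) ^ 2 + y ^ 2 ≤ 1} =
        Icc (-√(1 - y ^ 2)) (√(1 - y ^ 2) - r) := by
      ext x
      simp only [mem_ofPred_eq, mem_Icc, hchord, abs_le]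
      constructor
      · rintro ⟨⟨hleft, -⟩, -, hright⟩
        exact ⟨hleft, by linarith⟩
      · rintro ⟨hleft, hright⟩
        exact ⟨⟨hleft, by linarith⟩, by linarith, by linarith⟩
    rw [hset, Real.volume_Icc]
    ring_nf
  · have hempty : {x : ℝ | x ^ 2 + y ^ 2 ≤ 1 ∧ (x + r) ^ 2 + y ^ 2 ≤ 1} = ∅ := by
      refine eq_empty_of_forall_notMem fun x hx => ?_
      linarith [hx.1, sq_nonneg x]
    rw [hempty, Real.sqrt_eq_zero_of_nonpos (by linarith), measure_empty,
      ENNReal.ofReal_of_nonpos (by linarith)]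

lemma volume_chord (y : ℝ) :
    volume {x : ℝ | x ^ 2 + y ^ 2 ≤ 1} = ENNReal.ofReal (2 * √(1 - y ^ 2)) := by
  simpa using volume_chord_inter_translate le_rfl y

lemma lintegral_Ioi_mul_ofReal_sub {a : ℝ} (ha : 0 ≤ a) :
    ∫⁻ r in Ioi (0 : ℝ), ENNReal.ofReal r * ENNReal.ofReal (a - r) =
      ENNReal.ofReal (a ^ 3 / 6) := by
  have hind : ∀ r ∈ Ioi (0 : ℝ), ENNReal.ofReal r * ENNReal.ofReal (a - r) =
      (Ioc 0 a).indicator (fun r => ENNReal.ofReal (r * (a - r))) r := by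
    intro r hr
    by_cases hra : r ≤ a
    · rw [indicator_of_mem (show r ∈ Ioc 0 a from ⟨hr, hra⟩), ENNReal.ofReal_mul (le_of_lt hr)]
    · rw [indicator_of_notMem fun h => hra h.2, ENNReal.ofReal_of_nonpos (p := a - r) (by linarith),
        mul_zero]
  have hint : ∫ r in (0 : ℝ)..a, r * (a - r) = a ^ 3 / 6 := by
    simp_rw [mul_sub, mul_comm _ a, ← sq]
    rw [intervalIntegral.integral_sub (Continuous.intervalIntegrable (by fun_prop) _ _)
      (Continuous.intervalIntegrable (by fun_prop) _ _), intervalIntegral.integral_const_mul,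
      integral_id, integral_pow]
    norm_num
    ring
  rw [setLIntegral_congr_fun measurableSet_Ioi hind, lintegral_indicator measurableSet_Ioc,
    Measure.restrict_restrict measurableSet_Ioc, inter_eq_left.2 Ioc_subset_Ioi_self,
    ← ofReal_integral_eq_lintegral_ofReal, ← intervalIntegral.integral_of_le ha, hint]
  · exact (by fun_prop : Continuous fun r : ℝ => r * (a - r)).integrableOn_Ioc
  · filter_upwards [ae_restrict_mem measurableSet_Ioc] with r hr
    exact mul_nonneg hr.1.le (sub_nonneg.2 hr.2)

/-- The area of the part of the unit disc that lies within distance `h` of a diameter. -/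
noncomputable def stripArea (h : ℝ) : ℝ := ∫ y in -h..h, 2 * √(1 - y ^ 2)

lemma continuous_stripArea : Continuous stripArea := by
  have hint : ∀ a b : ℝ, IntervalIntegrable (fun y : ℝ => 2 * √(1 - y ^ 2)) volume a b :=
    fun a b => Continuous.intervalIntegrable (by fun_prop) a b
  have hsub : stripArea = fun h =>
      (∫ y in (0 : ℝ)..h, 2 * √(1 - y ^ 2)) - ∫ y in (0 : ℝ)..-h, 2 * √(1 - y ^ 2) := by
    ext h
    rw [stripArea, intervalIntegral.integral_interval_sub_left (hint _ _) (hint _ _)]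
  have hprim := intervalIntegral.continuous_primitive hint 0
  rw [hsub]
  exact hprim.sub (hprim.comp continuous_neg)

lemma stripArea_nonneg {h : ℝ} (hh : 0 ≤ h) : 0 ≤ stripArea h :=
  intervalIntegral.integral_nonneg (by linarith) fun y _ => by positivity

lemma ofReal_stripArea {h : ℝ} (hh : 0 ≤ h) :
    ENNReal.ofReal (stripArea h) = ∫⁻ y in Ioo (-h) h, ENNReal.ofReal (2 * √(1 - y ^ 2)) := by
  rw [stripArea, intervalIntegral.integral_of_le (by linarith), integral_Ioc_eq_integral_Ioo,
    ofReal_integral_eq_lintegral_ofReal]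
  · exact (by fun_prop : Continuous fun y : ℝ => 2 * √(1 - y ^ 2)).integrableOn_Icc.mono_set
      Ioo_subset_Icc_self
  · exact .of_forall fun y => by positivity

lemma integral_comp_sin_half {g : ℝ → ℝ} (hg : Continuous g) (a b : ℝ) :
    ∫ s in a..b, g (Real.sin (s / 2)) * (Real.cos (s / 2) / 2) =
      ∫ y in Real.sin (a / 2)..Real.sin (b / 2), g y := by
  refine intervalIntegral.integral_comp_mul_deriv (f := fun s => Real.sin (s / 2))
    (fun s _ => ?_) (by fun_prop) hg
  simpa [div_eq_mul_inv] using ((hasDerivAt_id s).div_const 2).sin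

lemma sqrt_one_sub_sin_half_sq {s : ℝ} (hs : |s| ≤ Real.pi) :
    √(1 - Real.sin (s / 2) ^ 2) = Real.cos (s / 2) := by
  have := abs_le.1 hs
  rw [← Real.cos_sq', Real.sqrt_sq (Real.cos_nonneg_of_mem_Icc ⟨by linarith, by linarith⟩)]

lemma two_mul_cos_half_sq (s : ℝ) : 2 * Real.cos (s / 2) ^ 2 = 1 + Real.cos s := by
  rw [Real.cos_sq, mul_div_cancel₀ _ two_ne_zero]
  ring

lemma stripArea_sin_half {t : ℝ} (ht : 0 ≤ t) (htpi : t ≤ Real.pi) :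
    stripArea (Real.sin (t / 2)) = t + Real.sin t := by
  rw [stripArea, ← Real.sin_neg, ← neg_div, ← integral_comp_sin_half (by fun_prop)]
  calc ∫ s in -t..t, 2 * √(1 - Real.sin (s / 2) ^ 2) * (Real.cos (s / 2) / 2)
      = ∫ s in -t..t, (1 + Real.cos s) / 2 := by
        refine intervalIntegral.integral_congr fun s hs => ?_
        rw [uIcc_of_le (by linarith)] at hs
        simp only [sqrt_one_sub_sin_half_sq ((abs_le.2 hs).trans htpi), ← two_mul_cos_half_sq]
        ring
    _ = t + Real.sin t := by
        rw [intervalIntegral.integral_div, intervalIntegral.integral_add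
          (Continuous.intervalIntegrable (by fun_prop) _ _)
          (Continuous.intervalIntegrable (by fun_prop) _ _), integral_cos,
          intervalIntegral.integral_const, Real.sin_neg, smul_eq_mul]
        ring

lemma chord_cube_eq_zero {y : ℝ} (hy : 1 ≤ |y|) : (2 * √(1 - y ^ 2)) ^ 3 / 6 = 0 := by
  have := (one_le_sq_iff_one_le_abs y).2 hy
  rw [Real.sqrt_eq_zero_of_nonpos (by linarith)]
  norm_num

lemma integral_stripArea_pow (n : ℕ) :
    ∫ y, stripArea |y| ^ n * ((2 * √(1 - y ^ 2)) ^ 3 / 6) =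
      1 / 3 * ∫ t in (0 : ℝ)..Real.pi, (t + Real.sin t) ^ n * (1 + Real.cos t) ^ 2 := by
  let g : ℝ → ℝ := fun y => stripArea y ^ n * ((2 * √(1 - y ^ 2)) ^ 3 / 6)
  have hg : Continuous g := (continuous_stripArea.pow n).mul (by fun_prop)
  have hsupp : ∀ y ∈ Ioi (0 : ℝ) \ Ioc 0 1, g y = 0 := fun y hy => by
    have hy1 : 1 ≤ |y| := (not_le.1 fun h => hy.2 ⟨hy.1, h⟩).le.trans (le_abs_self y)
    simp only [g, chord_cube_eq_zero hy1, mul_zero]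
  calc ∫ y, stripArea |y| ^ n * ((2 * √(1 - y ^ 2)) ^ 3 / 6) = ∫ y, g |y| := by
        simp only [g, sq_abs]
    _ = 2 * ∫ y in (0 : ℝ)..1, g y := by
        rw [integral_comp_abs, intervalIntegral.integral_of_le zero_le_one,
          setIntegral_eq_of_subset_of_forall_sdiff_eq_zero measurableSet_Ioi
            Ioc_subset_Ioi_self hsupp]
    _ = 2 * ∫ t in (0 : ℝ)..Real.pi, g (Real.sin (t / 2)) * (Real.cos (t / 2) / 2) := by
        rw [integral_comp_sin_half hg, zero_div, Real.sin_zero, Real.sin_pi_div_two]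
    _ = 2 * ∫ t in (0 : ℝ)..Real.pi,
          1 / 6 * ((t + Real.sin t) ^ n * (1 + Real.cos t) ^ 2) := by
        congr 1
        refine intervalIntegral.integral_congr fun t ht => ?_
        rw [uIcc_of_le Real.pi_pos.le] at ht
        simp only [g, stripArea_sin_half ht.1 ht.2, ← two_mul_cos_half_sq,
          sqrt_one_sub_sin_half_sq (abs_le.2 ⟨by linarith [ht.1, Real.pi_pos], ht.2⟩)]
        ring
    _ = 1 / 3 * ∫ t in (0 : ℝ)..Real.pi, (t + Real.sin t) ^ n * (1 + Real.cos t) ^ 2 := by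
        rw [intervalIntegral.integral_const_mul]
        ring

lemma lintegral_stripArea_pow (n : ℕ) :
    ∫⁻ y, ENNReal.ofReal (stripArea |y|) ^ n * ENNReal.ofReal ((2 * √(1 - y ^ 2)) ^ 3 / 6) =
      ENNReal.ofReal (1 / 3 * ∫ t in (0 : ℝ)..Real.pi,
        (t + Real.sin t) ^ n * (1 + Real.cos t) ^ 2) := by
  have hnonneg : ∀ y : ℝ, 0 ≤ stripArea |y| := fun y => stripArea_nonneg (abs_nonneg y)
  have hcont : Continuous fun y : ℝ => stripArea |y| ^ n * ((2 * √(1 - y ^ 2)) ^ 3 / 6) :=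
    ((continuous_stripArea.comp continuous_abs).pow n).mul (by fun_prop)
  have hsupp : HasCompactSupport fun y : ℝ => stripArea |y| ^ n * ((2 * √(1 - y ^ 2)) ^ 3 / 6) :=
    .intro (isCompact_Icc (a := -1) (b := 1)) fun y hy => by
      rw [chord_cube_eq_zero (not_le.1 fun h => hy (abs_le.1 h)).le, mul_zero]
  rw [← integral_stripArea_pow, ofReal_integral_eq_lintegral_ofReal
    (hcont.integrable_of_hasCompactSupport hsupp)
    (.of_forall fun y => mul_nonneg (pow_nonneg (hnonneg y) n) (by positivity))]
  refine lintegral_congr fun y => ?_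
  rw [ENNReal.ofReal_mul (pow_nonneg (hnonneg y) n), ENNReal.ofReal_pow (hnonneg y)]

end ChordIntegrals

section Translates

lemma setLIntegral_setLIntegral_eq_lintegral_translate {G : Type*} [AddCommGroup G]
    [MeasurableSpace G] [MeasurableAdd₂ G] {μ : Measure G} [SFinite μ] [μ.IsAddLeftInvariant]
    {s : Set G} (hs : MeasurableSet s) {f : G × G → ℝ≥0∞} (hf : Measurable f) :
    ∫⁻ p in s, ∫⁻ q in s, f (p, q) ∂μ ∂μ =
      ∫⁻ v, ∫⁻ p in {p | p ∈ s ∧ p + v ∈ s}, f (p, p + v) ∂μ ∂μ := by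
  have hsection : ∀ v, MeasurableSet {p | p ∈ s ∧ p + v ∈ s} := fun v =>
    hs.inter (hs.preimage (measurable_id.add_const v))
  have hmeas : Measurable fun y : G × G => (s ×ˢ s).indicator f (y.1, y.1 + y.2) :=
    (hf.indicator (hs.prod hs)).comp (measurable_fst.prodMk (measurable_fst.add measurable_snd))
  calc ∫⁻ p in s, ∫⁻ q in s, f (p, q) ∂μ ∂μ
      = ∫⁻ p, ∫⁻ q, (s ×ˢ s).indicator f (p, q) ∂μ ∂μ := by
        simp_rw [← lintegral_indicator hs]
        refine lintegral_congr fun p => ?_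
        by_cases hp : p ∈ s
        · rw [indicator_of_mem hp]
          exact lintegral_congr fun q => by by_cases hq : q ∈ s <;> simp [hp, hq]
        · simp [indicator, hp]
    _ = ∫⁻ p, ∫⁻ v, (s ×ˢ s).indicator f (p, p + v) ∂μ ∂μ :=
        lintegral_congr fun p => (lintegral_add_left_eq_self _ p).symm
    _ = ∫⁻ v, ∫⁻ p, (s ×ˢ s).indicator f (p, p + v) ∂μ ∂μ :=
        lintegral_lintegral_swap hmeas.aemeasurable
    _ = ∫⁻ v, ∫⁻ p in {p | p ∈ s ∧ p + v ∈ s}, f (p, p + v) ∂μ ∂μ := by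
        simp_rw [← lintegral_indicator (hsection _)]
        rfl

end Translates

section ComplexPlane

attribute [local instance] Complex.finrank_real_complex_fact

local notation "ω" => Complex.orientation.areaForm

lemma areaForm_circle_mul (c : Circle) (z w : ℂ) : ω (c * z) (c * w) = ω z w := by
  have hc : conj (c : ℂ) * c = 1 := by
    rw [mul_comm, Complex.mul_conj, Circle.normSq_coe, Complex.ofReal_one]
  rw [Complex.areaForm, Complex.areaForm, map_mul, mul_mul_mul_comm, hc, one_mul]

lemma areaForm_ofReal_right (z : ℂ) (r : ℝ) : ω z r = -(r * z.im) := by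
  simp [Complex.areaForm, mul_comm]

lemma exists_circle_mul_norm_eq (v : ℂ) : ∃ c : Circle, v = c * ‖v‖ :=
  ⟨Circle.exp v.arg, by rw [mul_comm, Circle.coe_exp, Complex.norm_mul_exp_arg_mul_I]⟩

lemma measurePreserving_circle_mul (c : Circle) : MeasurePreserving fun z : ℂ => c * z :=
  (rotation c).measurePreserving

lemma measurableEmbedding_circle_mul (c : Circle) : MeasurableEmbedding fun z : ℂ => c * z :=
  (rotation c).toHomeomorph.measurableEmbedding

lemma lintegral_eq_lintegral_Ioi_of_radial {g : ℂ → ℝ≥0∞} {h : ℝ → ℝ≥0∞} (hh : Measurable h)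
    (hgh : ∀ (c : Circle) (r : ℝ), 0 < r → g (c * r) = h r) :
    ∫⁻ z, g z = ENNReal.ofReal (2 * Real.pi) *
      ∫⁻ r in Ioi (0 : ℝ), ENNReal.ofReal r * h r := by
  have htarget : polarCoord.target = Ioi (0 : ℝ) ×ˢ Ioo (-Real.pi) Real.pi := rfl
  have hpolar : ∀ y ∈ polarCoord.target,
      ENNReal.ofReal y.1 • g (Complex.polarCoord.symm y) = ENNReal.ofReal y.1 * h y.1 * 1 :=
    fun y hy => by
      rw [← hgh (Circle.exp y.2) y.1 hy.1, Complex.polarCoord_symm_apply, Circle.coe_exp,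
        Complex.exp_mul_I, mul_comm (y.1 : ℂ), Complex.ofReal_cos, Complex.ofReal_sin, mul_one,
        smul_eq_mul]
  have hangle : volume (Ioo (-Real.pi) Real.pi) = ENNReal.ofReal (2 * Real.pi) := by
    rw [Real.volume_Ioo]
    ring_nf
  rw [← Complex.lintegral_comp_polarCoord_symm,
    setLIntegral_congr_fun polarCoord.open_target.measurableSet hpolar, htarget,
    Measure.volume_eq_prod, ← Measure.prod_restrict,
    lintegral_prod_mul (f := fun r => ENNReal.ofReal r * h r) (g := fun _ => 1)
      (ENNReal.measurable_ofReal.mul hh).aemeasurable aemeasurable_const,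
    lintegral_one, Measure.restrict_apply_univ, hangle, mul_comm]

lemma setLIntegral_comp_im {s : Set ℂ} (hs : MeasurableSet s) {φ : ℝ → ℝ≥0∞}
    (hφ : Measurable φ) :
    ∫⁻ z in s, φ z.im = ∫⁻ y : ℝ, φ y * volume {x : ℝ | (⟨x, y⟩ : ℂ) ∈ s} := by
  have hequiv := Complex.volume_preserving_equiv_real_prod.symm
  have hind : Measurable (s.indicator fun z => φ z.im) :=
    (hφ.comp Complex.measurable_im).indicator hs
  have hsection : ∀ y : ℝ, MeasurableSet {x : ℝ | (⟨x, y⟩ : ℂ) ∈ s} := fun y =>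
    hs.preimage (Complex.measurableEquivRealProd.symm.measurable.comp measurable_prodMk_right)
  rw [← lintegral_indicator hs, ← hequiv.lintegral_comp hind, Measure.volume_eq_prod,
    lintegral_prod_symm (fun y => s.indicator _ (Complex.measurableEquivRealProd.symm y))
      (hind.comp hequiv.measurable).aemeasurable]
  refine lintegral_congr fun y => ?_
  rw [← lintegral_indicator_const (hsection y)]
  rfl

lemma circle_mul_mem_closedBall (c : Circle) {z : ℂ} {r : ℝ} :
    c * z ∈ closedBall (0 : ℂ) r ↔ z ∈ closedBall (0 : ℂ) r := by
  rw [mem_closedBall_zero_iff, mem_closedBall_zero_iff, norm_mul, Circle.norm_coe, one_mul]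

lemma mem_closedBall_zero_one_iff {z : ℂ} :
    z ∈ closedBall (0 : ℂ) 1 ↔ z.re ^ 2 + z.im ^ 2 ≤ 1 := by
  rw [mem_closedBall_zero_iff, ← sq_le_one_iff₀ (norm_nonneg z), Complex.sq_norm,
    Complex.normSq_apply, sq, sq]

/-- The distance from the origin to the line through `p` and `q`, with the junk value `0` when
`p = q`. -/
noncomputable def originLineDist (p q : ℂ) : ℝ := |ω p q| / ‖q - p‖

lemma originLineDist_nonneg (p q : ℂ) : 0 ≤ originLineDist p q := by
  unfold originLineDist
  positivity

lemma originLineDist_self (p : ℂ) : originLineDist p p = 0 := by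
  rw [originLineDist, sub_self, norm_zero, div_zero]

lemma measurable_originLineDist : Measurable fun y : ℂ × ℂ => originLineDist y.1 y.2 :=
  (measurable_areaForm measurable_fst measurable_snd).norm.div
    (measurable_snd.sub measurable_fst).norm

lemma originLineDist_circle_mul (c : Circle) (p q : ℂ) :
    originLineDist (c * p) (c * q) = originLineDist p q := by
  rw [originLineDist, areaForm_circle_mul, ← mul_sub, norm_mul, Circle.norm_coe, one_mul,
    originLineDist]

lemma originLineDist_add_ofReal (p : ℂ) {r : ℝ} (hr : 0 < r) :
    originLineDist p (p + r) = |p.im| := by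
  rw [originLineDist, map_add, Orientation.areaForm_apply_self, zero_add, areaForm_ofReal_right,
    abs_neg, abs_mul, add_sub_cancel_left, Complex.norm_real, Real.norm_eq_abs,
    mul_div_cancel_left₀ _ (abs_pos.2 hr.ne').ne']

lemma setLIntegral_originLineDist_add_ofReal {φ : ℝ → ℝ≥0∞} (hφ : Measurable φ) {r : ℝ}
    (hr : 0 < r) :
    ∫⁻ p in {p | p ∈ closedBall (0 : ℂ) 1 ∧ p + r ∈ closedBall (0 : ℂ) 1},
        φ (originLineDist p (p + r)) =
      ∫⁻ y : ℝ, φ |y| * ENNReal.ofReal (2 * √(1 - y ^ 2) - r) := by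
  have hlens : MeasurableSet {p : ℂ | p ∈ closedBall (0 : ℂ) 1 ∧ p + r ∈ closedBall (0 : ℂ) 1} :=
    measurableSet_closedBall.inter (measurableSet_closedBall.preimage (measurable_id.add_const _))
  simp_rw [originLineDist_add_ofReal _ hr]
  rw [setLIntegral_comp_im (φ := fun y => φ |y|) hlens (hφ.comp measurable_norm)]
  refine lintegral_congr fun y => ?_
  rw [← volume_chord_inter_translate hr.le]
  simp only [mem_ofPred_eq, mem_closedBall_zero_one_iff, Complex.add_re, Complex.add_im,
    Complex.ofReal_re, Complex.ofReal_im, add_zero]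

lemma setLIntegral_originLineDist_circle_mul {φ : ℝ → ℝ≥0∞} (c : Circle) (v : ℂ) :
    ∫⁻ p in {p | p ∈ closedBall (0 : ℂ) 1 ∧ p + c * v ∈ closedBall (0 : ℂ) 1},
        φ (originLineDist p (p + c * v)) =
      ∫⁻ p in {p | p ∈ closedBall (0 : ℂ) 1 ∧ p + v ∈ closedBall (0 : ℂ) 1},
        φ (originLineDist p (p + v)) := by
  rw [← (measurePreserving_circle_mul c).setLIntegral_comp_preimage_emb
    (measurableEmbedding_circle_mul c)]
  simp only [← mul_add, originLineDist_circle_mul, preimage_ofPred_eq, circle_mul_mem_closedBall]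

/-- A planar Blaschke–Petkantschin formula: writing `q = p + r e^{iθ}`, the pair is determined by
the chord of the disc that carries it, the position of `p` on the chord and `r`, and a chord of
length `ℓ` contributes `∫ r (ℓ - r) dr = ℓ ^ 3 / 6`. -/
lemma setLIntegral_setLIntegral_originLineDist {φ : ℝ → ℝ≥0∞} (hφ : Measurable φ) :
    ∫⁻ p in closedBall (0 : ℂ) 1, ∫⁻ q in closedBall (0 : ℂ) 1, φ (originLineDist p q) =
      ENNReal.ofReal (2 * Real.pi) *
        ∫⁻ y : ℝ, φ |y| * ENNReal.ofReal ((2 * √(1 - y ^ 2)) ^ 3 / 6) := by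
  have hmeas : Measurable fun x : ℝ × ℝ =>
      φ |x.2| * ENNReal.ofReal (2 * √(1 - x.2 ^ 2) - x.1) := by fun_prop
  rw [setLIntegral_setLIntegral_eq_lintegral_translate measurableSet_closedBall
      (f := fun y => φ (originLineDist y.1 y.2)) (hφ.comp measurable_originLineDist),
    lintegral_eq_lintegral_Ioi_of_radial hmeas.lintegral_prod_right' fun c r hr =>
      (setLIntegral_originLineDist_circle_mul c r).trans
        (setLIntegral_originLineDist_add_ofReal hφ hr)]
  congr 1
  calc ∫⁻ r in Ioi (0 : ℝ), ENNReal.ofReal r *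
        ∫⁻ y : ℝ, φ |y| * ENNReal.ofReal (2 * √(1 - y ^ 2) - r)
      = ∫⁻ r in Ioi (0 : ℝ), ∫⁻ y : ℝ, ENNReal.ofReal r *
          (φ |y| * ENNReal.ofReal (2 * √(1 - y ^ 2) - r)) := by
        simp_rw [lintegral_const_mul' _ _ ENNReal.ofReal_ne_top]
    _ = ∫⁻ y : ℝ, ∫⁻ r in Ioi (0 : ℝ), ENNReal.ofReal r *
          (φ |y| * ENNReal.ofReal (2 * √(1 - y ^ 2) - r)) :=
        lintegral_lintegral_swap
          ((ENNReal.measurable_ofReal.comp measurable_fst).mul hmeas).aemeasurable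
    _ = ∫⁻ y : ℝ, φ |y| * ENNReal.ofReal ((2 * √(1 - y ^ 2)) ^ 3 / 6) := by
        refine lintegral_congr fun y => ?_
        simp_rw [mul_left_comm _ (φ |y|)]
        rw [lintegral_const_mul _ (by fun_prop), lintegral_Ioi_mul_ofReal_sub (by positivity)]

lemma volume_closedBall_inter_abs_im_lt {h : ℝ} (hh : 0 ≤ h) :
    volume (closedBall (0 : ℂ) 1 ∩ {z | |z.im| < h}) = ENNReal.ofReal (stripArea h) := by
  have hIoo : {z : ℂ | |z.im| < h} = Complex.im ⁻¹' Ioo (-h) h :=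
    ext fun z => abs_lt (a := z.im)
  have hindicator : Measurable ((Ioo (-h) h).indicator (1 : ℝ → ℝ≥0∞)) :=
    measurable_one.indicator measurableSet_Ioo
  have hchord : ∀ y : ℝ, volume {x : ℝ | (⟨x, y⟩ : ℂ) ∈ closedBall (0 : ℂ) 1} =
      ENNReal.ofReal (2 * √(1 - y ^ 2)) := fun y => by
    simp only [mem_closedBall_zero_one_iff, volume_chord]
  calc volume (closedBall (0 : ℂ) 1 ∩ {z | |z.im| < h})
      = ∫⁻ z in closedBall (0 : ℂ) 1, (Ioo (-h) h).indicator 1 z.im := by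
        rw [hIoo, inter_comm, ← Measure.restrict_apply
          (measurableSet_Ioo.preimage Complex.measurable_im), ← lintegral_indicator_one
          (measurableSet_Ioo.preimage Complex.measurable_im)]
        rfl
    _ = ENNReal.ofReal (stripArea h) := by
        rw [setLIntegral_comp_im measurableSet_closedBall hindicator, ofReal_stripArea hh,
          ← lintegral_indicator measurableSet_Ioo]
        refine lintegral_congr fun y => ?_
        rw [hchord]
        by_cases hy : y ∈ Ioo (-h) h <;> simp [indicator, hy]

lemma volume_closedBall_inter_strip (p q : ℂ) :
    volume (closedBall (0 : ℂ) 1 ∩ strip Complex.orientation p q) =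
      ENNReal.ofReal (stripArea (originLineDist p q)) := by
  rcases eq_or_ne p q with rfl | hne
  · have hempty : strip Complex.orientation p p = ∅ :=
      eq_empty_of_forall_notMem fun z hz => by simp [strip] at hz
    simp [hempty, originLineDist_self, stripArea]
  obtain ⟨c, hc⟩ := exists_circle_mul_norm_eq (p - q)
  have hnorm : 0 < ‖p - q‖ := norm_pos_iff.2 (sub_ne_zero.2 hne)
  rw [← (measurePreserving_circle_mul c).measure_preimage_emb (measurableEmbedding_circle_mul c),
    ← volume_closedBall_inter_abs_im_lt (originLineDist_nonneg p q)]
  congr 1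
  ext z
  have habs : |ω (p - q) (c * z)| = |z.im| * ‖p - q‖ := by
    rw [hc, Orientation.areaForm_swap, areaForm_circle_mul, areaForm_ofReal_right, ← hc, neg_neg,
      abs_mul, abs_norm, mul_comm]
  rw [mem_preimage, mem_inter_iff, mem_inter_iff, circle_mul_mem_closedBall, strip, mem_ofPred_eq,
    mem_ofPred_eq, habs, originLineDist, norm_sub_rev q, lt_div_iff₀ hnorm]

/-- The uniform distribution on the unit disc of the plane. -/
noncomputable def discMeasure : Measure ℂ := volume[|closedBall 0 1]

lemma volume_closedBall_zero_one : volume (closedBall (0 : ℂ) 1) = ENNReal.ofReal Real.pi := by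
  rw [Complex.volume_closedBall, ENNReal.ofReal_one, one_pow, one_mul,
    ← ENNReal.ofReal_coe_nnreal, NNReal.coe_real_pi]

lemma discMeasure_eq_smul :
    discMeasure = (ENNReal.ofReal Real.pi)⁻¹ • volume.restrict (closedBall 0 1) := by
  rw [discMeasure, ProbabilityTheory.cond, volume_closedBall_zero_one]

instance : IsProbabilityMeasure discMeasure :=
  ProbabilityTheory.cond_isProbabilityMeasure_of_finite (measure_closedBall_pos _ _ one_pos).ne'
    measure_closedBall_lt_top.ne

instance : discMeasure.IsNegInvariant where
  neg_eq_self := by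
    have hneg := (Measure.measurePreserving_neg (volume : Measure ℂ)).restrict_preimage
      (s := closedBall 0 1) measurableSet_closedBall
    rw [neg_preimage, neg_closedBall, neg_zero] at hneg
    rw [discMeasure_eq_smul]
    exact (hneg.smul_measure _).map_eq

lemma chargesNoHyperplane_discMeasure : ChargesNoHyperplane discMeasure :=
  chargesNoHyperplane_of_absolutelyContinuous ProbabilityTheory.cond_absolutelyContinuous

lemma lintegral_discMeasure_strip_pow (n : ℕ) :
    ∫⁻ y, discMeasure (strip Complex.orientation y.1 y.2) ^ n ∂discMeasure.prod discMeasure =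
      ENNReal.ofReal (2 / (3 * Real.pi ^ (n + 1)) * ∫ t in (0 : ℝ)..Real.pi,
        (t + Real.sin t) ^ n * (1 + Real.cos t) ^ 2) := by
  have hstrip : ∀ p q, discMeasure (strip Complex.orientation p q) =
      (ENNReal.ofReal Real.pi)⁻¹ * ENNReal.ofReal (stripArea (originLineDist p q)) := fun p q => by
    rw [← volume_closedBall_inter_strip, ← volume_closedBall_zero_one,
      ← ProbabilityTheory.cond_apply measurableSet_closedBall, discMeasure]
  have hpow : Measurable fun h : ℝ => ENNReal.ofReal (stripArea h) ^ n :=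
    (ENNReal.measurable_ofReal.comp continuous_stripArea.measurable).pow_const n
  have hinv : (ENNReal.ofReal Real.pi)⁻¹ = ENNReal.ofReal Real.pi⁻¹ :=
    (ENNReal.ofReal_inv_of_pos Real.pi_pos).symm
  rw [lintegral_prod _ (measurable_measure_strip.pow_const n).aemeasurable]
  simp_rw [hstrip, mul_pow, hinv, ← ENNReal.ofReal_pow (inv_nonneg.2 Real.pi_pos.le),
    lintegral_const_mul' _ _ ENNReal.ofReal_ne_top, discMeasure_eq_smul, hinv,
    lintegral_smul_measure, smul_eq_mul, lintegral_const_mul' _ _ ENNReal.ofReal_ne_top]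
  rw [setLIntegral_setLIntegral_originLineDist hpow, lintegral_stripArea_pow,
    ← ENNReal.ofReal_mul (by positivity), ← ENNReal.ofReal_mul (by positivity),
    ← ENNReal.ofReal_mul (by positivity), ← ENNReal.ofReal_mul (by positivity)]
  congr 1
  rw [inv_pow]
  field_simp
  ring

lemma meanHullMass_discMeasure (n : ℕ) :
    meanHullMass discMeasure (n + 1) =
      1 - 2 * ((n : ℝ) + 1) / (3 * Real.pi ^ (n + 1)) *
        ∫ t in (0 : ℝ)..Real.pi, (t + Real.sin t) ^ n * (1 + Real.cos t) ^ 2 := by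
  have hnonneg : 0 ≤ ∫ t in (0 : ℝ)..Real.pi, (t + Real.sin t) ^ n * (1 + Real.cos t) ^ 2 :=
    intervalIntegral.integral_nonneg Real.pi_pos.le fun t ht => by
      have := Real.sin_nonneg_of_mem_Icc ht
      have := ht.1
      positivity
  rw [meanHullMass_eq_one_sub, measureReal_def,
    measure_prod_notMem_absConvexHull (o := Complex.orientation) chargesNoHyperplane_discMeasure,
    lintegral_discMeasure_strip_pow, ENNReal.toReal_mul, ENNReal.toReal_ofReal (by positivity)]
  have hn : ((n : ℝ≥0∞) + 1).toReal = n + 1 := by norm_cast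
  rw [hn]
  ring

end ComplexPlane

section LinearEquiv

variable {V W : Type*} [NormedAddCommGroup V] [NormedSpace ℝ V] [MeasurableSpace V] [BorelSpace V]
  [NormedAddCommGroup W] [NormedSpace ℝ W] [MeasurableSpace W] [BorelSpace W]

lemma map_cond_eq_cond_image [FiniteDimensional ℝ W] (L : V ≃L[ℝ] W) (μ : Measure V)
    [μ.IsAddHaarMeasure] (ν : Measure W) [ν.IsAddHaarMeasure] {s : Set V} (hs : MeasurableSet s) :
    μ[|s].map L = ν[|L '' s] := by
  have := L.isAddHaarMeasure_map μ
  set c := (μ.map L).addHaarScalarFactor ν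
  have hc : c ≠ 0 := (Measure.addHaarScalarFactor_pos_of_isAddHaarMeasure _ _).ne'
  have hmap : μ.map L = c • ν := Measure.isAddLeftInvariant_eq_smul _ _
  have hL : MeasurableEmbedding L := L.toHomeomorph.measurableEmbedding
  have hvol : ∀ t, μ t = c * ν (L '' t) := fun t => by
    rw [← preimage_image_eq t L.injective, ← hL.map_apply, hmap, preimage_image_eq t L.injective]
    rfl
  refine Measure.ext fun t _ => ?_
  rw [hL.map_apply, ProbabilityTheory.cond_apply hs,
    ProbabilityTheory.cond_apply (hL.measurableSet_image.2 hs), hvol, hvol, image_inter_preimage,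
    ENNReal.mul_inv (.inl (by simpa using hc)) (.inl ENNReal.coe_ne_top), mul_mul_mul_comm,
    ENNReal.inv_mul_cancel (by simpa using hc) ENNReal.coe_ne_top, one_mul]

lemma meanHullMass_map [SecondCountableTopology V] [SecondCountableTopology W] (L : V ≃L[ℝ] W)
    (ρ : Measure V) [IsProbabilityMeasure ρ] (N : ℕ) :
    meanHullMass (ρ.map L) N = meanHullMass ρ N := by
  have hL : MeasurableEmbedding L := L.toHomeomorph.measurableEmbedding
  have : IsProbabilityMeasure (ρ.map L) :=
    Measure.isProbabilityMeasure_map hL.measurable.aemeasurable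
  have hhull : ∀ x : Fin N → V, (ρ.map L).real (absConvexHull ℝ (range fun i => L (x i))) =
      ρ.real (absConvexHull ℝ (range x)) := fun x => by
    have himage : L '' absConvexHull ℝ (range x) = absConvexHull ℝ (range fun i => L (x i)) :=
      image_absConvexHull_range (L : V →ₗ[ℝ] W) x
    rw [measureReal_def, hL.map_apply, ← himage, preimage_image_eq _ L.injective, measureReal_def]
  have hmeas : Measurable fun y : Fin N → W => (ρ.map L).real (absConvexHull ℝ (range y)) :=
    (measurable_measure_absConvexHull_range _).ennreal_toReal
  have hpi : Measurable fun (x : Fin N → V) i => L (x i) :=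
    measurable_pi_lambda _ fun i => hL.measurable.comp (measurable_pi_apply i)
  rw [meanHullMass, ← Measure.pi_map_pi fun _ => hL.measurable.aemeasurable,
    integral_map hpi.aemeasurable hmeas.aestronglyMeasurable]
  exact integral_congr_ae (.of_forall hhull)

end LinearEquiv

section UniformPoints

variable {n N : ℕ} {K : Set (EuclideanSpace ℝ (Fin n))}

lemma normalizedSymVolume_eq_cond (hK : MeasurableSet K) (hconvex : AbsConvex ℝ K)
    {x : Fin N → EuclideanSpace ℝ (Fin n)} (hx : ∀ i, x i ∈ K) :
    normalizedSymVolume K x = volume[|K].real (absConvexHull ℝ (range x)) := by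
  have hsubset : absConvexHull ℝ (range x) ⊆ K :=
    absConvexHull_min (range_subset_iff.2 hx) hconvex
  rw [normalizedSymVolume, symmetricHull, convexHull_range_union_range_neg, measureReal_def,
    measureReal_def, measureReal_def, ProbabilityTheory.cond_apply hK, inter_eq_right.2 hsubset,
    ENNReal.toReal_mul, ENNReal.toReal_inv, div_eq_inv_mul]

variable {Ω : Type*} [MeasurableSpace Ω] {P : Measure Ω} [IsProbabilityMeasure P]
  {x : Fin N → Ω → EuclideanSpace ℝ (Fin n)}

lemma integrable_and_integral_normalizedSymVolume [IsProbabilityMeasure (volume[|K])]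
    (hK : MeasurableSet K) (hconvex : AbsConvex ℝ K) (hindep : ProbabilityTheory.iIndepFun x P)
    (hunif : ∀ i, pdf.IsUniform (x i) K P volume) :
    Integrable (fun ω => normalizedSymVolume K fun i => x i ω) P ∧
      ∫ ω, normalizedSymVolume K (fun i => x i ω) ∂P = meanHullMass volume[|K] N := by
  have hx : ∀ i, AEMeasurable (x i) P := fun i => AEMeasurable.of_map_ne_zero <| by
    rw [hunif i]
    exact IsProbabilityMeasure.ne_zero _
  have hlaw : P.map (fun ω i => x i ω) = Measure.pi fun _ => volume[|K] := by
    rw [(ProbabilityTheory.iIndepFun_iff_map_fun_eq_pi_map hx).1 hindep]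
    exact congrArg _ (funext hunif)
  have hmem : ∀ᵐ ω ∂P, ∀ i, x i ω ∈ K := ae_all_iff.2 fun i => ae_of_ae_map (hx i) <| by
    rw [hunif i]
    exact ProbabilityTheory.ae_cond_mem hK
  have hvol : (fun ω => normalizedSymVolume K fun i => x i ω) =ᵐ[P]
      fun ω => volume[|K].real (absConvexHull ℝ (range fun i => x i ω)) :=
    hmem.mono fun ω => normalizedSymVolume_eq_cond hK hconvex
  have hmeas : Measurable fun y : Fin N → EuclideanSpace ℝ (Fin n) =>
      volume[|K].real (absConvexHull ℝ (range y)) :=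
    (measurable_measure_absConvexHull_range _).ennreal_toReal
  have hxs : AEMeasurable (fun ω i => x i ω) P := aemeasurable_pi_lambda _ hx
  constructor
  · refine (Integrable.of_bound (hmeas.comp_aemeasurable hxs).aestronglyMeasurable 1
      (.of_forall fun ω => ?_)).congr hvol.symm
    rw [Function.comp_apply, Real.norm_of_nonneg measureReal_nonneg]
    exact measureReal_le_one
  · rw [integral_congr_ae hvol, meanHullMass, ← hlaw,
      integral_map hxs hmeas.aestronglyMeasurable]

end UniformPoints

/-- The linear map that takes the unit disc to the ellipse with axes `b` and semi-axes `a`. -/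
noncomputable def ellipseEquiv (b : OrthonormalBasis (Fin 2) ℝ (EuclideanSpace ℝ (Fin 2)))
    (a : Fin 2 → ℝ) (ha : ∀ i, 0 < a i) : ℂ ≃L[ℝ] EuclideanSpace ℝ (Fin 2) :=
  LinearEquiv.toContinuousLinearEquiv
    { toFun := fun z => (a 0 * z.re) • b 0 + (a 1 * z.im) • b 1
      map_add' := fun z w => by simp only [Complex.add_re, Complex.add_im]; module
      map_smul' := fun r z => by
        simp only [Complex.real_smul, Complex.mul_re, Complex.mul_im, Complex.ofReal_re,
          Complex.ofReal_im, RingHom.id_apply]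
        module
      invFun := fun x => ⟨inner ℝ (b 0) x / a 0, inner ℝ (b 1) x / a 1⟩
      left_inv := fun z => by
        have h0 := (ha 0).ne'
        have h1 := (ha 1).ne'
        apply Complex.ext <;>
          simp [inner_add_right, inner_smul_right, b.inner_eq_ite, h0, h1]
      right_inv := fun x => by
        simp only [mul_div_cancel₀ _ (ha _).ne']
        rw [← Fin.sum_univ_two (fun i => inner ℝ (b i) x • b i), b.sum_repr'] }

lemma ellipseEquiv_image_closedBall (b : OrthonormalBasis (Fin 2) ℝ (EuclideanSpace ℝ (Fin 2)))
    (a : Fin 2 → ℝ) (ha : ∀ i, 0 < a i) :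
    ellipseEquiv b a ha '' closedBall 0 1 = {x | ∑ i, (inner ℝ (b i) x / a i) ^ 2 ≤ 1} := by
  ext x
  rw [(ellipseEquiv b a ha).image_eq_preimage_symm, mem_preimage, mem_closedBall_zero_one_iff,
    mem_ofPred_eq, Fin.sum_univ_two]
  rfl

theorem mainTheorem6 {Ω : Type*} [MeasurableSpace Ω] (P : MeasureTheory.Measure Ω)
    [MeasureTheory.IsProbabilityMeasure P]
    (E : Set (EuclideanSpace ℝ (Fin 2))) (hE : IsCenteredEllipse E)
    (N : ℕ) (hN : 2 ≤ N)
    (x : Fin N → Ω → EuclideanSpace ℝ (Fin 2))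
    (hindep : ProbabilityTheory.iIndepFun x P)
    (hunif : ∀ i, MeasureTheory.pdf.IsUniform (x i) E P MeasureTheory.volume) :
    MeasureTheory.Integrable (fun ω => normalizedSymVolume E (fun i => x i ω)) P ∧
      ∫ ω, normalizedSymVolume E (fun i => x i ω) ∂P =
        1 - 2 * (N : ℝ) / (3 * Real.pi ^ N) *
          ∫ t in (0 : ℝ)..Real.pi, (t + Real.sin t) ^ (N - 1) * (1 + Real.cos t) ^ 2 := by
  obtain ⟨b, a, ha, rfl⟩ := hE
  obtain ⟨n, rfl⟩ : ∃ n, N = n + 1 := ⟨N - 1, by omega⟩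
  rw [← ellipseEquiv_image_closedBall b a ha] at hunif ⊢
  set L := ellipseEquiv b a ha
  have hmeas : MeasurableSet (L '' closedBall 0 1) :=
    L.toHomeomorph.measurableEmbedding.measurableSet_image.2 measurableSet_closedBall
  have hconvex : AbsConvex ℝ (L '' closedBall 0 1) :=
    absConvex_image L.toLinearMap ⟨balanced_closedBall_zero, convex_closedBall 0 1⟩
  have hlaw : volume[|L '' closedBall 0 1] = discMeasure.map L :=
    (map_cond_eq_cond_image L volume volume measurableSet_closedBall).symm
  have : IsProbabilityMeasure (volume[|L '' closedBall 0 1]) :=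
    hlaw ▸ Measure.isProbabilityMeasure_map L.continuous.aemeasurable
  obtain ⟨hint, hmean⟩ := integrable_and_integral_normalizedSymVolume hmeas hconvex hindep hunif
  refine ⟨hint, ?_⟩
  rw [hmean, hlaw, meanHullMass_map, meanHullMass_discMeasure, Nat.add_sub_cancel, Nat.cast_succ]
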